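/- **Matrix alt-dPI system.** Let $\lambda,\mu,\nu\in\mathbb C^{N\times N}$ with $\nu$ Hermitian negative definite, and let $\Gamma$ be the branch $x<0$ of the hyperbola $3x^2-y^2=3$ in the plane $z=x+iy$ (or, in the mirror-image case, let $\nu$ be Hermitian positive definite and $\Gamma$ the branch $x>0$), oriented by increasing $y$. Let $W:\Gamma\to\mathbb C^{N\times N}$ be a solution along $\Gamma$ of the Pearson equation $$W'(z)=(\lambda+\mu z+\nu z^2)\,W(z).$$ Then all moments $W_k=\frac1{2\pi i}\int_\Gamma z^kW(z)\,dz$ converge absolutely. Suppose that $W$ is regular, i.e. $\det[W_{j+k}]_{j,k=0}^{n}\neq0$ for all $n\ge 0$, and let $P_n(z)=Iz^n+p_n^1z^{n-1}+\cdots$, $n\ge0$, be the monic left orthogonal matrix polynomials, $$\frac1{2\pi i}\int_\Gamma P_n(z)W(z)z^k\,dz=\delta_{n,k}C_n^{-1},\qquad 0\le k\le n,$$ with $C_n$ nonsingular. Let $$\beta_n=p_n^1-p_{n+1}^1\ (n\ge 0,\ p_0^1=0),\qquad \gamma_n=C_n^{-1}C_{n-1}\ (n\ge1),\qquad \gamma_0=0,$$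 be the recursion coefficients in $zP_n=P_{n+1}+\beta_nP_n+\gamma_nP_{n-1}$, and write $[A,B]=AB-BA$. Then, for all $n\ge0$, $$\Big(\mu+\Big[\nu,\sum_{k=0}^{n-1}\beta_k\Big]+\nu(\beta_n+\beta_{n+1})\Big)\gamma_{n+1}=-(n+1)I,$$ $$\lambda+\nu\big(\gamma_n+\gamma_{n+1}+\beta_n^2\big)+\mu\beta_n+\Big[\mu,\sum_{k=0}^{n-1}\beta_k\Big]+\Big[\nu,\sum_{m=1}^{n-1}\gamma_m-\sum_{0\le k<m\le n-1}\beta_m\beta_k\Big]+\Big[\nu,\sum_{k=0}^{n-1}\beta_k\Big]\Big(\sum_{k=0}^{n-1}\beta_k+\beta_n\Big)=0.$$ Consequently the matrix $A_n:=\mu+[\nu,\sum_{k=0}^{n-1}\beta_k]+\nu(\beta_n+\beta_{n+1})$ is invertible, $\gamma_{n+1}=-(n+1)A_n^{-1}$, and the $\beta_n$ satisfy the closed non-Abelian alternate discrete Painlevé I equation that is obtained from the second relation by replacing each $\gamma_m$ with $m\ge1$ by $-mA_{m-1}^{-1}$ (and $\gamma_0$ by $0$). -/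

import Mathlib

open Finset Polynomial
open scoped ComplexOrder

noncomputable section

namespace AltDPI

/-- The branch `s * x > 0` (`s = 1` or `s = -1`) of the hyperbola `3 x ^ 2 - y ^ 2 = 3`,
parametrized by `z(t) = s cosh t + i √3 sinh t`. -/
def branch (s : ℝ) (t : ℝ) : ℂ :=
  ((s * Real.cosh t : ℝ) : ℂ) + ((Real.sqrt 3 * Real.sinh t : ℝ) : ℂ) * Complex.I

/-- `W' = (lam + mu z + nu z ^ 2) W`, entry by entry, along the set `Γ`. -/
def PearsonOn {N : ℕ} (lam mu nu : Matrix (Fin N) (Fin N) ℂ) (Γ : Set ℂ)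
    (W : ℂ → Matrix (Fin N) (Fin N) ℂ) : Prop :=
  ∀ z ∈ Γ, ∀ i j, HasDerivWithinAt (fun w => W w i j)
    (((lam + z • mu + z ^ 2 • nu) * W z) i j) Γ z

/-- `(1 / (2 π i)) ∫_Γ F(z) dz` for a matrix valued function, entry by entry. -/
def curveInt {N : ℕ} (s : ℝ) (F : ℂ → Matrix (Fin N) (Fin N) ℂ) : Matrix (Fin N) (Fin N) ℂ :=
  Matrix.of fun i j =>
    (2 * (Real.pi : ℂ) * Complex.I)⁻¹ * ∫ t : ℝ, F (branch s t) i j * deriv (branch s) t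

/-- The moment of order `n` of the matrix of weights `W`. -/
def moment {N : ℕ} (s : ℝ) (W : ℂ → Matrix (Fin N) (Fin N) ℂ) (n : ℕ) :
    Matrix (Fin N) (Fin N) ℂ :=
  curveInt s fun z => z ^ n • W z

/-- All block Hankel determinants `det [W_{j+k}]_{j,k=0..n}` are nonzero. -/
def IsRegular {N : ℕ} (s : ℝ) (W : ℂ → Matrix (Fin N) (Fin N) ℂ) : Prop :=
  ∀ n : ℕ, (Matrix.of fun p q : Fin (n + 1) × Fin N =>
    moment s W ((p.1 : ℕ) + (q.1 : ℕ)) p.2 q.2).det ≠ 0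

/-- `P` is the sequence of monic left orthogonal matrix polynomials of `W`, with nonsingular
normalization matrices `C`:  `(1 / (2 π i)) ∫ P_n(z) W(z) z ^ k dz = δ_{n,k} C_n⁻¹`, `k ≤ n`.
The polynomial `P_n` is evaluated at `z` through the scalar matrix `z I`. -/
structure IsLeftOrthogonal {N : ℕ} (s : ℝ) (W : ℂ → Matrix (Fin N) (Fin N) ℂ)
    (P : ℕ → (Matrix (Fin N) (Fin N) ℂ)[X]) (C : ℕ → Matrix (Fin N) (Fin N) ℂ) : Prop where
  degree_le : ∀ n : ℕ, (P n).degree ≤ n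
  coeff_self : ∀ n : ℕ, (P n).coeff n = 1
  isUnit : ∀ n : ℕ, IsUnit (C n)
  orthogonal : ∀ n k : ℕ, k ≤ n →
    curveInt s (fun z => z ^ k • ((P n).eval (Matrix.scalar (Fin N) z) * W z)) =
      if n = k then (C n)⁻¹ else 0

/-- `p_n^1`: the coefficient of `z ^ (n - 1)` in `P_n`, and `0` for `n = 0`. -/
def subleading {N : ℕ} (P : ℕ → (Matrix (Fin N) (Fin N) ℂ)[X]) :
    ℕ → Matrix (Fin N) (Fin N) ℂ
  | 0 => 0
  | n + 1 => (P (n + 1)).coeff n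

/-- `β_n = p_n^1 - p_{n+1}^1`. -/
def recBeta {N : ℕ} (P : ℕ → (Matrix (Fin N) (Fin N) ℂ)[X]) (n : ℕ) :
    Matrix (Fin N) (Fin N) ℂ :=
  subleading P n - subleading P (n + 1)

/-- `γ_n = C_n⁻¹ C_{n-1}` for `n ≥ 1`; `γ_0 = 0`, in accordance with `P_{-1} = 0`. -/
def recGamma {N : ℕ} (C : ℕ → Matrix (Fin N) (Fin N) ℂ) : ℕ → Matrix (Fin N) (Fin N) ℂ
  | 0 => 0
  | n + 1 => (C (n + 1))⁻¹ * C n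

/-- `A_n = mu + [nu, ∑_{k<n} β_k] + nu (β_n + β_{n+1})`. -/
def coeffA {N : ℕ} (mu nu : Matrix (Fin N) (Fin N) ℂ) (β : ℕ → Matrix (Fin N) (Fin N) ℂ)
    (n : ℕ) : Matrix (Fin N) (Fin N) ℂ :=
  mu + ⁅nu, ∑ k ∈ range n, β k⁆ + nu * (β n + β (n + 1))

/-- The expression of `γ_n` through the `β`'s: `0` for `n = 0` and `-n A_{n-1}⁻¹` for `n ≥ 1`. -/
def gammaOfBeta {N : ℕ} (mu nu : Matrix (Fin N) (Fin N) ℂ)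
    (β : ℕ → Matrix (Fin N) (Fin N) ℂ) : ℕ → Matrix (Fin N) (Fin N) ℂ
  | 0 => 0
  | n + 1 => -((n : ℂ) + 1) • (coeffA mu nu β n)⁻¹

/-- The left hand side of the non-Abelian alternate discrete Painlevé I equation. -/
def altDPI {N : ℕ} (lam mu nu : Matrix (Fin N) (Fin N) ℂ)
    (β γ : ℕ → Matrix (Fin N) (Fin N) ℂ) (n : ℕ) : Matrix (Fin N) (Fin N) ℂ :=
  lam + nu * (γ n + γ (n + 1) + β n ^ 2) + mu * β n
    + ⁅mu, ∑ k ∈ range n, β k⁆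
    + ⁅nu, (∑ m ∈ Ico 1 n, γ m) - ∑ m ∈ range n, ∑ k ∈ range m, β m * β k⁆
    + ⁅nu, ∑ k ∈ range n, β k⁆ * ((∑ k ∈ range n, β k) + β n)

end AltDPI

end

/-! Write `D = lam + mu z + nu z²`, so `W' = D W`, and let `L(p) = (2πi)⁻¹ ∫_Γ p W dz`. The branch
is asymptotic to rays on which `s z³` is negative. As `s * nu` is positive definite, the leading
term `nu z³ / 3` makes each column of `W` decay faster than any exponential in `t`
(`isBigO_exp_of_pearson`). Hence the moments exist and `∫ (z^k W)' dz = 0`, which is a recurrence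
for the moments, or equivalently `L(p D + p') = 0` for every polynomial `p`.

The rest is algebra over a noncommutative ring. By this identity `P_n D + P_n'`, of degree at most
`n + 2`, is orthogonal to `z^k` for `k ≤ n`, so it equals `nu P_{n+2} + b P_{n+1}` with `b = -(n+1)
γ_{n+1}⁻¹` (`structure_relation`). The coefficient of `z^(n+1)` gives `b = A_n`, which is the first
equation; that of `z^n` gives the second, once the two subleading coefficients of `P_n` are
expressed through `β` and `γ` by the three-term recurrence (`coeffTwo_eq_sum`). -/

namespace AltDPI

/-! ### Orthogonal polynomials for a moment functional over a noncommutative ring. -/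

section Functional

variable {R : Type*} [Ring R]

/-- The left linear functional on `R[X]` with moments `m`. -/
noncomputable def momentFunctional (m : ℕ → R) : R[X] →ₗ[R] R where
  toFun p := p.sum fun i a => a * m i
  map_add' p q := Polynomial.sum_add_index p q _ (by simp) (by intros; rw [add_mul])
  map_smul' a p := by
    rw [Polynomial.sum_smul_index p a _ (by simp)]
    simp [Polynomial.sum_def, Finset.mul_sum, mul_assoc]

theorem momentFunctional_monomial (m : ℕ → R) (i : ℕ) (a : R) :
    momentFunctional m (monomial i a) = a * m i := by
  simp [momentFunctional]

theorem momentFunctional_C_mul (m : ℕ → R) (a : R) (p : R[X]) :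
    momentFunctional m (Polynomial.C a * p) = a * momentFunctional m p := by
  rw [← Polynomial.smul_eq_C_mul, map_smul, smul_eq_mul]

/-- Monic left orthogonal polynomials for the functional with moments `m`, with
normalizations `u n`. -/
structure IsMonicOrthogonal (m : ℕ → R) (P : ℕ → R[X]) (u : ℕ → Rˣ) : Prop where
  degree_le : ∀ n : ℕ, (P n).degree ≤ n
  coeff_self : ∀ n : ℕ, (P n).coeff n = 1
  orthogonal : ∀ n k : ℕ, k < n → momentFunctional m (P n * X ^ k) = 0
  normalized : ∀ n : ℕ, momentFunctional m (P n * X ^ n) = ((u n)⁻¹ : Rˣ)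

variable {m : ℕ → R} {P : ℕ → R[X]} {u : ℕ → Rˣ}

theorem degree_sub_C_mul_lt {p q : R[X]} {n : ℕ} (hp : p.degree < (n + 1 : ℕ))
    (hq : q.degree ≤ n) (hq1 : q.coeff n = 1) :
    (p - Polynomial.C (p.coeff n) * q).degree < n := by
  rw [Polynomial.degree_lt_iff_coeff_zero] at hp ⊢
  rw [Polynomial.degree_le_iff_coeff_zero] at hq
  intro k hk
  rcases hk.eq_or_lt with rfl | hk
  · simp [hq1]
  · simp [hp k hk, hq k (by exact_mod_cast hk)]

theorem momentFunctional_sub_C_mul (p q : R[X]) (a : R) (k : ℕ) :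
    momentFunctional m ((p - Polynomial.C a * q) * X ^ k) =
      momentFunctional m (p * X ^ k) - a * momentFunctional m (q * X ^ k) := by
  rw [sub_mul, map_sub, mul_assoc, momentFunctional_C_mul]

namespace IsMonicOrthogonal

/-- Nondegeneracy comes from the invertible normalizations: subtracting the top coefficient times `P
n` lowers the degree, and pairing with `X ^ n` then forces that coefficient to vanish. -/
theorem eq_zero_of_orthogonal (h : IsMonicOrthogonal m P u) (n : ℕ) :
    ∀ p : R[X], p.degree < n → (∀ k < n, momentFunctional m (p * X ^ k) = 0) → p = 0 := by
  induction n with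
  | zero => intro p hp _; exact Polynomial.degree_eq_bot.1 (by simpa using hp)
  | succ n ih =>
    intro p hp hk
    have h0 : p - Polynomial.C (p.coeff n) * P n = 0 := by
      refine ih _ (degree_sub_C_mul_lt hp (h.degree_le n) (h.coeff_self n)) fun k hkn => ?_
      rw [momentFunctional_sub_C_mul, hk k (by omega), h.orthogonal n k hkn, mul_zero, sub_zero]
    have h1 := momentFunctional_sub_C_mul (m := m) p (P n) (p.coeff n) n
    rw [h0, hk n (by omega), h.normalized n] at h1
    have h2 : p.coeff n = 0 := by
      have : p.coeff n * ((u n)⁻¹ : Rˣ) = 0 := by simpa using h1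
      simpa using this
    simpa [h2] using h0

/-- Used to identify the remainders in the three-term and structure relations. -/
theorem eq_of_orthogonal (h : IsMonicOrthogonal m P u) {n : ℕ} {p : R[X]}
    (hp : p.degree < (n + 1 : ℕ)) (hk : ∀ k < n, momentFunctional m (p * X ^ k) = 0) :
    p = Polynomial.C (p.coeff n) * P n ∧
      p.coeff n = momentFunctional m (p * X ^ n) * u n := by
  have h0 : p - Polynomial.C (p.coeff n) * P n = 0 := by
    refine h.eq_zero_of_orthogonal n _
      (degree_sub_C_mul_lt hp (h.degree_le n) (h.coeff_self n)) fun k hkn => ?_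
    rw [momentFunctional_sub_C_mul, hk k hkn, h.orthogonal n k hkn, mul_zero, sub_zero]
  refine ⟨sub_eq_zero.1 h0, ?_⟩
  have h1 := momentFunctional_sub_C_mul (m := m) p (P n) (p.coeff n) n
  rw [h0, h.normalized n, zero_mul, map_zero, eq_comm, sub_eq_zero] at h1
  rw [h1, mul_assoc, Units.inv_mul, mul_one]

theorem three_term (h : IsMonicOrthogonal m P u) (n : ℕ) :
    X * P (n + 1) = P (n + 2) + Polynomial.C ((P (n + 1)).coeff n - (P (n + 2)).coeff (n + 1)) *
      P (n + 1) + Polynomial.C (((u (n + 1))⁻¹ * u n : Rˣ) : R) * P n := by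
  have hd1 : ∀ j k, j < k → (P j).coeff k = 0 := fun j k hjk =>
    Polynomial.coeff_eq_zero_of_degree_lt ((h.degree_le j).trans_lt (by exact_mod_cast hjk))
  set q := X * P (n + 1) - P (n + 2) with hq
  have hq1 : q.degree < (n + 1 + 1 : ℕ) := by
    rw [Polynomial.degree_lt_iff_coeff_zero]
    intro k hk
    obtain ⟨k, rfl⟩ : ∃ j, k = j + 1 := ⟨k - 1, by omega⟩
    rw [hq, coeff_sub, coeff_X_mul]
    rcases (show n + 1 ≤ k by omega).eq_or_lt with rfl | hk
    · rw [h.coeff_self, h.coeff_self, sub_self]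
    · rw [hd1 _ _ hk, hd1 _ _ (by omega), sub_self]
  have hc : q.coeff (n + 1) = (P (n + 1)).coeff n - (P (n + 2)).coeff (n + 1) := by
    rw [hq, coeff_sub, coeff_X_mul]
  have hqk : ∀ k < n + 1, momentFunctional m (q * X ^ k) =
      momentFunctional m (P (n + 1) * X ^ (k + 1)) := by
    intro k hk
    rw [hq, sub_mul, map_sub, h.orthogonal _ k (by omega), sub_zero, X_mul, mul_assoc, pow_succ']
  have hr := degree_sub_C_mul_lt hq1 (h.degree_le (n + 1)) (h.coeff_self _)
  have hrk : ∀ k < n + 1, momentFunctional m ((q - Polynomial.C (q.coeff (n + 1)) * P (n + 1)) *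
      X ^ k) = momentFunctional m (P (n + 1) * X ^ (k + 1)) := by
    intro k hk
    rw [momentFunctional_sub_C_mul, h.orthogonal _ k hk, mul_zero, sub_zero, hqk k hk]
  obtain ⟨h1, h2⟩ := h.eq_of_orthogonal hr
    fun k hk => by rw [hrk k (by omega), h.orthogonal _ _ (by omega)]
  rw [hrk n (by omega), h.normalized] at h2
  rw [h2, hc, sub_eq_iff_eq_add, hq, sub_eq_iff_eq_add] at h1
  rw [h1, Units.val_mul]
  abel

variable {lam mu nu : R}

/-- Left linearity reduces to monomials `a X ^ n`, where the claim is `a` times `hm n`. For `n = 0`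
the truncated index `k - 1` is harmless, since its factor is `0`. -/
theorem momentFunctional_pearson
    (hm : ∀ k : ℕ, lam * m k + mu * m (k + 1) + nu * m (k + 2) + k * m (k - 1) = 0) (p : R[X]) :
    momentFunctional m (p * (Polynomial.C lam + Polynomial.C mu * X + Polynomial.C nu * X ^ 2) +
      derivative p) = 0 := by
  induction p using Polynomial.induction_on' with
  | add p q hp hq =>
    rw [derivative_add, add_mul, add_add_add_comm, map_add, hp, hq, add_zero]
  | monomial n a =>
    have h1 : monomial n a *
        (Polynomial.C lam + Polynomial.C mu * X + Polynomial.C nu * X ^ 2) =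
        monomial n (a * lam) + monomial (n + 1) (a * mu) + monomial (n + 2) (a * nu) := by
      rw [X_pow_eq_monomial, ← monomial_one_one_eq_X]
      simp only [mul_add, C_mul_monomial, monomial_mul_monomial, monomial_mul_C, mul_one]
    rw [h1, derivative_monomial, map_add, map_add, map_add]
    simp only [momentFunctional_monomial]
    rw [← mul_zero a, ← hm n]
    simp only [mul_add, mul_assoc]

/-- The structure relation `P_n D + P_n' = ν P_{n+2} + b P_{n+1}`. -/
theorem structure_relation (h : IsMonicOrthogonal m P u)
    (hm : ∀ k : ℕ, lam * m k + mu * m (k + 1) + nu * m (k + 2) + k * m (k - 1) = 0) (n : ℕ) :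
    P n * (Polynomial.C lam + Polynomial.C mu * X + Polynomial.C nu * X ^ 2) +
      derivative (P n) = Polynomial.C nu * P (n + 2) +
        Polynomial.C (-((n : R) + 1) * ((u n)⁻¹ * u (n + 1) : Rˣ)) * P (n + 1) := by
  have hd1 : ∀ j k, j < k → (P j).coeff k = 0 := fun j k hjk =>
    Polynomial.coeff_eq_zero_of_degree_lt ((h.degree_le j).trans_lt (by exact_mod_cast hjk))
  set D : R[X] := Polynomial.C lam + Polynomial.C mu * X + Polynomial.C nu * X ^ 2 with hD
  set q := P n * D + derivative (P n) with hq
  have hcoeff : ∀ k, q.coeff (k + 2) = (P n).coeff (k + 2) * lam + (P n).coeff (k + 1) * mu +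
      (P n).coeff k * nu + (P n).coeff (k + 3) * ((k : R) + 3) := by
    intro k
    rw [hq, hD, mul_add, mul_add, ← mul_assoc, ← mul_assoc]
    simp only [coeff_add, coeff_mul_C, coeff_mul_X, coeff_mul_X_pow, coeff_derivative]
    congr 2
    push_cast
    rw [add_assoc]; norm_num
  have hq1 : q.degree < (n + 2 + 1 : ℕ) := by
    rw [Polynomial.degree_lt_iff_coeff_zero]
    intro k hk
    obtain ⟨k, rfl⟩ : ∃ j, k = j + 2 := ⟨k - 2, by omega⟩
    rw [hcoeff, hd1 n _ (by omega), hd1 n _ (by omega), hd1 n _ (by omega), hd1 n _ (by omega)]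
    simp
  have hc : q.coeff (n + 2) = nu := by
    rw [hcoeff, hd1 n _ (by omega), hd1 n _ (by omega), hd1 n (n + 3) (by omega), h.coeff_self]
    simp
  -- Integration by parts: apply the Pearson identity to `P n * X ^ k`. The result vanishes for `k ≤
  -- n`, and `k = n + 1` produces the factor `-(n + 1)` of the second coefficient.
  have hqk : ∀ k : ℕ, momentFunctional m (q * X ^ k) =
      - (momentFunctional m (P n * X ^ (k - 1) * (k : R[X]))) := by
    intro k
    have h1 := momentFunctional_pearson hm (P n * X ^ k)
    have h2 : P n * X ^ k * D + derivative (P n * X ^ k) =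
        q * X ^ k + P n * X ^ (k - 1) * (k : R[X]) := by
      rw [hq, derivative_mul, derivative_X_pow, add_mul, mul_assoc _ _ D, mul_assoc _ D,
        X_pow_mul, mul_assoc, add_assoc]
      congr 3
      rw [Polynomial.C_eq_natCast, (Nat.cast_commute k _).eq]
    rw [h2, map_add] at h1
    exact eq_neg_of_add_eq_zero_left h1
  have hqk0 : ∀ k < n + 1, momentFunctional m (q * X ^ k) = 0 := by
    intro k hk
    rcases k with _ | k
    · rw [hqk]; simp
    · rw [hqk, ← (Nat.cast_commute _ _).eq, ← C_eq_natCast, momentFunctional_C_mul,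
        Nat.add_sub_cancel, h.orthogonal n k (by omega), mul_zero, neg_zero]
  have hr := degree_sub_C_mul_lt hq1 (h.degree_le (n + 2)) (h.coeff_self _)
  have hrk : ∀ k < n + 2, momentFunctional m ((q - Polynomial.C (q.coeff (n + 2)) * P (n + 2)) *
      X ^ k) = momentFunctional m (q * X ^ k) := by
    intro k hk
    rw [momentFunctional_sub_C_mul, h.orthogonal _ k hk, mul_zero, sub_zero]
  obtain ⟨h1, h2⟩ := h.eq_of_orthogonal hr
    fun k hk => by rw [hrk k (by omega), hqk0 _ (by omega)]
  rw [hrk _ (by omega), hqk, ← (Nat.cast_commute (α := R[X]) _ _).eq, ← C_eq_natCast, momentFunctional_C_mul,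
    Nat.add_sub_cancel, h.normalized] at h2
  rw [h2, hc, sub_eq_iff_eq_add] at h1
  rw [h1, add_comm, Units.val_mul]
  push_cast
  simp only [neg_mul, mul_assoc]

/-- `p_n^1`, the coefficient of `X ^ (n - 1)` of `P n`. -/
noncomputable def coeffOne (P : ℕ → R[X]) (n : ℕ) : R := (X ^ 2 * P n).coeff (n + 1)

/-- `p_n^2`, the coefficient of `X ^ (n - 2)` of `P n`. -/
noncomputable def coeffTwo (P : ℕ → R[X]) (n : ℕ) : R := (X ^ 2 * P n).coeff n

theorem coeffOne_zero (P : ℕ → R[X]) : coeffOne P 0 = 0 := by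
  simp [coeffOne, coeff_X_pow_mul']

theorem coeffOne_succ (P : ℕ → R[X]) (n : ℕ) : coeffOne P (n + 1) = (P (n + 1)).coeff n := by
  simp [coeffOne, coeff_X_pow_mul']

theorem coeff_eq_zero (h : IsMonicOrthogonal m P u) {j k : ℕ} (hjk : j < k) :
    (P j).coeff k = 0 :=
  Polynomial.coeff_eq_zero_of_degree_lt ((h.degree_le j).trans_lt (by exact_mod_cast hjk))

/-- `γ_n`, with `γ_0 = 0`. -/
noncomputable def gammaOf (u : ℕ → Rˣ) : ℕ → R
  | 0 => 0
  | n + 1 => ((u (n + 1))⁻¹ * u n : Rˣ)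

/-- For `n ≥ 1` this is the coefficient of `X ^ (n - 1)` in the three-term relation; for `n = 0` all
terms vanish, because the shift by `X ^ 2` turns missing coefficients into `0`. -/
theorem coeffTwo_succ (h : IsMonicOrthogonal m P u) (n : ℕ) :
    coeffTwo P n = coeffTwo P (n + 1) +
      (coeffOne P n - coeffOne P (n + 1)) * coeffOne P n + gammaOf u n := by
  rcases n with _ | n
  · simp [coeffTwo, coeffOne_zero, gammaOf, coeff_X_pow_mul']
  · have h1 := congrArg (fun p : R[X] => (X * p).coeff (n + 1)) (h.three_term n)
    simp only [mul_add, coeff_add, coeff_X_mul, coeff_C_mul, h.coeff_self, mul_one] at h1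
    have h2 : coeffTwo P (n + 2) = (P (n + 2)).coeff n := by
      rw [coeffTwo, coeff_X_pow_mul]
    have h3 : coeffTwo P (n + 1) = (X * P (n + 1)).coeff n := by
      rw [coeffTwo, sq, mul_assoc, coeff_X_mul]
    rw [h2, h3, h1, coeffOne_succ, coeffOne_succ, gammaOf]

/-- Both formulas telescope, the second through `coeffTwo_succ`. -/
theorem coeffTwo_eq_sum (h : IsMonicOrthogonal m P u) {β : ℕ → R}
    (hβ : ∀ n, β n = coeffOne P n - coeffOne P (n + 1)) (n : ℕ) :
    coeffOne P n = -∑ k ∈ range n, β k ∧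
    coeffTwo P n = (∑ i ∈ range n, ∑ k ∈ range i, β i * β k) - ∑ i ∈ range n, gammaOf u i := by
  induction n with
  | zero => simp [coeffOne_zero, coeffTwo]
  | succ n ih =>
    have h1 := h.coeffTwo_succ n
    rw [← hβ, ih.1, ih.2, add_assoc, ← sub_eq_iff_eq_add] at h1
    refine ⟨?_, ?_⟩
    · rw [sum_range_succ, neg_add, ← ih.1, hβ]; abel
    · rw [← h1, sum_range_succ, sum_range_succ _ n, ← Finset.mul_sum, mul_neg]; abel

/-- Comparison of the coefficients in the structure relation. -/
theorem coeff_structure_relation (h : IsMonicOrthogonal m P u)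
    (hm : ∀ k : ℕ, lam * m k + mu * m (k + 1) + nu * m (k + 2) + k * m (k - 1) = 0) (n : ℕ) :
    ∃ b : R, b * gammaOf u (n + 1) = -((n : R) + 1) ∧
      mu + coeffOne P n * nu = nu * coeffOne P (n + 2) + b ∧
      lam + coeffOne P n * mu + coeffTwo P n * nu =
        nu * coeffTwo P (n + 2) + b * coeffOne P (n + 1) := by
  refine ⟨-((n : R) + 1) * ((u n)⁻¹ * u (n + 1) : Rˣ), ?_, ?_, ?_⟩
  · rw [gammaOf, mul_assoc, ← Units.val_mul]; simp
  -- Coefficient of `X ^ (n + 1)`. Here, and for `X ^ n` below, `derivative (P n)` has too small a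
  -- degree to contribute.
  · have h1 := congrArg (fun p : R[X] => (X ^ 2 * p).coeff (n + 3)) (h.structure_relation hm n)
    have h2 : (P n * (Polynomial.C mu * X)).coeff (n + 1) = mu := by
      rw [← mul_assoc, coeff_mul_X, coeff_mul_C, h.coeff_self, one_mul]
    have h3 : (X ^ 2 * (P n * (Polynomial.C nu * X ^ 2))).coeff (n + 3) = coeffOne P n * nu := by
      rw [← mul_assoc, ← mul_assoc, coeff_mul_X_pow, coeff_mul_C, coeffOne]
    have h4 : (X ^ 2 * (Polynomial.C nu * P (n + 2))).coeff (n + 3) = nu * coeffOne P (n + 2) := by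
      rw [← mul_assoc, X_pow_mul_C, mul_assoc, coeff_C_mul, coeffOne]
    simp only [mul_add, coeff_add] at h1
    rw [h3, h4, show n + 3 = n + 1 + 2 from rfl, coeff_X_pow_mul, coeff_X_pow_mul, coeff_X_pow_mul,
      coeff_X_pow_mul, coeff_mul_C, h2, coeff_C_mul, coeff_derivative, h.coeff_self,
      h.coeff_eq_zero (show n < n + 1 by omega), h.coeff_eq_zero (show n < n + 1 + 1 by omega)] at h1
    simpa using h1
  · have h1 := congrArg (fun p : R[X] => (X ^ 2 * p).coeff (n + 2)) (h.structure_relation hm n)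
    have h2 : (X ^ 2 * (P n * (Polynomial.C mu * X))).coeff (n + 2) = coeffOne P n * mu := by
      rw [← mul_assoc, ← mul_assoc, coeff_mul_X, coeff_mul_C, coeffOne]
    have h3 : (X ^ 2 * (P n * (Polynomial.C nu * X ^ 2))).coeff (n + 2) = coeffTwo P n * nu := by
      rw [← mul_assoc, ← mul_assoc, coeff_mul_X_pow, coeff_mul_C, coeffTwo]
    have h4 : (X ^ 2 * (Polynomial.C nu * P (n + 2))).coeff (n + 2) = nu * coeffTwo P (n + 2) := by
      rw [← mul_assoc, X_pow_mul_C, mul_assoc, coeff_C_mul, coeffTwo]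
    simp only [mul_add, coeff_add] at h1
    rw [h2, h3, h4, coeff_X_pow_mul, coeff_X_pow_mul, coeff_X_pow_mul, coeff_mul_C, coeff_C_mul,
      coeff_derivative, h.coeff_self, h.coeff_eq_zero (show n < n + 1 by omega)] at h1
    simpa [coeffOne_succ] using h1

end IsMonicOrthogonal

end Functional

/-! ### From the coefficient identities to the alt-dPI system. -/

section System

variable {N : ℕ} {m : ℕ → Matrix (Fin N) (Fin N) ℂ} {P : ℕ → (Matrix (Fin N) (Fin N) ℂ)[X]}
  {C : ℕ → Matrix (Fin N) (Fin N) ℂ} {u : ℕ → (Matrix (Fin N) (Fin N) ℂ)ˣ}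
  {lam mu nu : Matrix (Fin N) (Fin N) ℂ}

theorem gammaOf_eq_recGamma (hC : ∀ n, C n = u n) :
    IsMonicOrthogonal.gammaOf u = recGamma C := by
  funext n
  rcases n with _ | n
  · rfl
  · rw [IsMonicOrthogonal.gammaOf, recGamma, hC, hC, Units.val_mul, Matrix.coe_units_inv]

theorem coeffOne_eq_subleading : IsMonicOrthogonal.coeffOne P = subleading P := by
  funext n
  rcases n with _ | n
  · exact IsMonicOrthogonal.coeffOne_zero P
  · exact IsMonicOrthogonal.coeffOne_succ P n

theorem IsMonicOrthogonal.altDPI_system (h : IsMonicOrthogonal m P u) (hC : ∀ n, C n = u n)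
    (hm : ∀ k : ℕ, lam * m k + mu * m (k + 1) + nu * m (k + 2) + k * m (k - 1) = 0) (n : ℕ) :
    coeffA mu nu (recBeta P) n * recGamma C (n + 1) =
        -((n : ℂ) + 1) • (1 : Matrix (Fin N) (Fin N) ℂ) ∧
      altDPI lam mu nu (recBeta P) (recGamma C) n = 0 := by
  obtain ⟨b, hb, h1, h2⟩ := h.coeff_structure_relation hm n
  have hβ : ∀ n, recBeta P n = coeffOne P n - coeffOne P (n + 1) := fun n => by
    rw [coeffOne_eq_subleading, recBeta]
  obtain ⟨p1, p2⟩ := h.coeffTwo_eq_sum hβ n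
  obtain ⟨p1', -⟩ := h.coeffTwo_eq_sum hβ (n + 1)
  obtain ⟨p1'', p2''⟩ := h.coeffTwo_eq_sum hβ (n + 2)
  have hG : ∑ i ∈ range n, gammaOf u i = ∑ i ∈ Ico 1 n, gammaOf u i := by
    rcases n with _ | n
    · simp
    · rw [range_eq_Ico, sum_eq_sum_Ico_succ_bot (by omega)]; simp [gammaOf]
  rw [p1, p1''] at h1
  rw [p1, p2, p2'', p1'] at h2
  simp only [sum_range_succ, ← Finset.mul_sum, hG] at h1 h2
  rw [← gammaOf_eq_recGamma hC]
  -- The commutator arises because `nu` stands right of `p_n^1` in `P_n D` but left of `p_{n+2}^1`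
  -- in `nu P_{n+2}`.
  have hA : b = coeffA mu nu (recBeta P) n := by
    rw [← sub_eq_iff_eq_add'] at h1
    rw [← h1, coeffA, Ring.lie_def]
    noncomm_ring
  refine ⟨?_, ?_⟩
  · rw [← hA, hb, ← Nat.cast_succ, neg_smul, ← Nat.cast_succ, Nat.cast_smul_eq_nsmul,
      nsmul_one]
  · rw [hA, coeffA, ← sub_eq_zero] at h2
    rw [← h2, altDPI]
    simp only [Ring.lie_def, ← Finset.mul_sum]
    noncomm_ring

/-- A right inverse of a square matrix is two-sided, and `n + 1 ≠ 0` in `ℂ`. -/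
theorem altDPI_elimination {β γ : ℕ → Matrix (Fin N) (Fin N) ℂ} (h0 : γ 0 = 0)
    (h : ∀ n, coeffA mu nu β n * γ (n + 1) =
        -((n : ℂ) + 1) • (1 : Matrix (Fin N) (Fin N) ℂ)) :
    (∀ n, IsUnit (coeffA mu nu β n)) ∧ γ = gammaOfBeta mu nu β := by
  have hn : ∀ n : ℕ, -((n : ℂ) + 1) ≠ 0 := fun n => neg_ne_zero.2 n.cast_add_one_ne_zero
  have hA : ∀ n, coeffA mu nu β n * ((-((n : ℂ) + 1))⁻¹ • γ (n + 1)) = 1 := fun n => by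
    rw [Matrix.mul_smul, h, smul_smul, inv_mul_cancel₀ (hn n), one_smul]
  refine ⟨fun n => IsUnit.of_mul_eq_one _ (hA n), funext fun n => ?_⟩
  rcases n with _ | n
  · exact h0
  · rw [gammaOfBeta, Matrix.inv_eq_right_inv (hA n), smul_smul, mul_inv_cancel₀ (hn n), one_smul]

end System

/-! ### Decay of solutions along the hyperbola and vanishing boundary terms. -/

section Decay

open Filter Asymptotics Matrix Topology

variable {N : ℕ}

theorem norm_mul_norm_le_sum_sq (v : Fin N → ℂ) (i j : Fin N) :
    ‖v i‖ * ‖v j‖ ≤ ∑ k, ‖v k‖ ^ 2 := by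
  have h : ∀ k, ‖v k‖ ^ 2 ≤ ∑ k, ‖v k‖ ^ 2 := fun k =>
    single_le_sum (f := fun k => ‖v k‖ ^ 2) (fun _ _ => by positivity) (mem_univ k)
  nlinarith [sq_nonneg (‖v i‖ - ‖v j‖), h i, h j]

theorem norm_star_dotProduct_mulVec_le (M : Matrix (Fin N) (Fin N) ℂ) (v : Fin N → ℂ) :
    ‖star v ⬝ᵥ (M *ᵥ v)‖ ≤ (∑ i, ∑ j, ‖M i j‖) * ∑ k, ‖v k‖ ^ 2 := by
  have h : star v ⬝ᵥ (M *ᵥ v) = ∑ i, ∑ j, star v i * (M i j * v j) := by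
    simp only [dotProduct, mulVec, Finset.mul_sum]
  rw [h, Finset.sum_mul]
  refine (norm_sum_le _ _).trans (sum_le_sum fun i _ => (norm_sum_le _ _).trans ?_)
  rw [Finset.sum_mul]
  refine sum_le_sum fun j _ => ?_
  rw [norm_mul, norm_mul, Pi.star_apply, norm_star, mul_left_comm]
  exact mul_le_mul_of_nonneg_left (norm_mul_norm_le_sum_sq v i j) (norm_nonneg _)

theorem star_dotProduct_self (v : Fin N → ℂ) :
    star v ⬝ᵥ v = ((∑ k, ‖v k‖ ^ 2 : ℝ) : ℂ) := by
  simp [dotProduct, Complex.conj_mul']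

/-- Factor `M = Bᴴ B` with `B` invertible and bound `|v|² = |B⁻¹ (B v)|²` by a multiple of `|B v|²`.
The `+ 1` in the constant covers `a = 0`. -/
theorem exists_pos_le_star_dotProduct_mulVec {M : Matrix (Fin N) (Fin N) ℂ} (hM : M.PosDef) :
    ∃ δ : ℝ, 0 < δ ∧ ∀ v : Fin N → ℂ, δ * ∑ k, ‖v k‖ ^ 2 ≤ (star v ⬝ᵥ (M *ᵥ v)).re := by
  obtain ⟨B, hB, rfl⟩ : ∃ B : Matrix (Fin N) (Fin N) ℂ, IsUnit B ∧ M = Bᴴ * B := by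
    open scoped MatrixOrder in
    exact CStarAlgebra.isStrictlyPositive_iff_eq_star_mul_self.mp hM.isStrictlyPositive
  set a := ∑ i, ∑ j, ‖(B⁻¹ᴴ * B⁻¹) i j‖
  have ha : 0 ≤ a := by positivity
  refine ⟨(a + 1)⁻¹, by positivity, fun v => ?_⟩
  have h1 : star v ⬝ᵥ ((Bᴴ * B) *ᵥ v) = star (B *ᵥ v) ⬝ᵥ (B *ᵥ v) := by
    rw [← mulVec_mulVec, dotProduct_mulVec, star_mulVec]
  have h2 : star (B *ᵥ v) ⬝ᵥ ((B⁻¹ᴴ * B⁻¹) *ᵥ (B *ᵥ v)) = star v ⬝ᵥ v := by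
    have h3 : B⁻¹ *ᵥ (B *ᵥ v) = v := by
      rw [mulVec_mulVec, nonsing_inv_mul _ ((isUnit_iff_isUnit_det _).1 hB), one_mulVec]
    rw [← mulVec_mulVec, dotProduct_mulVec, ← star_mulVec, h3]
  have h4 := norm_star_dotProduct_mulVec_le (B⁻¹ᴴ * B⁻¹) (B *ᵥ v)
  rw [h2, star_dotProduct_self, Complex.norm_of_nonneg (by positivity)] at h4
  rw [h1, star_dotProduct_self, Complex.ofReal_re, inv_mul_le_iff₀ (by positivity)]
  have h5 : 0 ≤ ∑ k, ‖(B *ᵥ v) k‖ ^ 2 := by positivity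
  linarith

/-- A function with `φ' ≤ -2 K φ` eventually decays at least like `exp (-2 K t)`. -/
theorem le_mul_exp_of_deriv_le {φ φ' : ℝ → ℝ} {K T : ℝ} (hφ : ∀ t, HasDerivAt φ (φ' t) t)
    (h : ∀ t, T ≤ t → φ' t ≤ -(2 * K) * φ t) {t : ℝ} (ht : T ≤ t) :
    φ t ≤ φ T * Real.exp (2 * K * T) * Real.exp (-(2 * K * t)) := by
  have hd : ∀ t, HasDerivAt (fun t => φ t * Real.exp (2 * K * t))
      (φ' t * Real.exp (2 * K * t) + φ t * (Real.exp (2 * K * t) * (2 * K))) t := fun t =>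
    (hφ t).mul (by simpa using ((hasDerivAt_id t).const_mul (2 * K)).exp)
  have hanti : AntitoneOn (fun t => φ t * Real.exp (2 * K * t)) (Set.Ici T) := by
    refine antitoneOn_of_deriv_nonpos (convex_Ici T)
      (fun t _ => (hd t).continuousAt.continuousWithinAt)
      (fun t _ => (hd t).differentiableAt.differentiableWithinAt) fun t ht => ?_
    rw [interior_Ici] at ht
    rw [(hd t).deriv]
    have := mul_le_mul_of_nonneg_right (h t (le_of_lt ht)) (Real.exp_pos (2 * K * t)).le
    linarith
  have h1 := hanti Set.self_mem_Ici ht ht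
  rw [Real.exp_neg, ← div_eq_mul_inv, le_div_iff₀ (Real.exp_pos _)]
  exact h1

/-- The hyperbola `s cosh t + i r sinh t`. -/
noncomputable def hyperbola (s r t : ℝ) : ℂ :=
  ((s * Real.cosh t : ℝ) : ℂ) + ((r * Real.sinh t : ℝ) : ℂ) * Complex.I

/-- The velocity of `hyperbola`. -/
noncomputable def hyperbolaDeriv (s r t : ℝ) : ℂ :=
  ((s * Real.sinh t : ℝ) : ℂ) + ((r * Real.cosh t : ℝ) : ℂ) * Complex.I

theorem hasDerivAt_hyperbola (s r t : ℝ) :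
    HasDerivAt (hyperbola s r) (hyperbolaDeriv s r t) t :=
  (((Real.hasDerivAt_cosh t).const_mul s).ofReal_comp).add
    ((((Real.hasDerivAt_sinh t).const_mul r).ofReal_comp).mul_const _)

theorem norm_hyperbola_le {s r : ℝ} (hs : s ^ 2 = 1) (hr : r ^ 2 = 3) (t : ℝ) :
    ‖hyperbola s r t‖ ≤ 2 * Real.cosh t := by
  have hc := Real.cosh_pos t
  refine abs_le_of_sq_le_sq' ?_ (by positivity) |>.2
  rw [← Complex.normSq_eq_norm_sq, Complex.normSq_apply]
  simp only [hyperbola, Complex.add_re, Complex.add_im, Complex.ofReal_re, Complex.ofReal_im,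
    Complex.mul_re, Complex.mul_im, Complex.I_re, Complex.I_im]
  nlinarith [Real.cosh_sq t]

theorem norm_hyperbolaDeriv_le {s r : ℝ} (hs : s ^ 2 = 1) (hr : r ^ 2 = 3) (t : ℝ) :
    ‖hyperbolaDeriv s r t‖ ≤ 2 * Real.cosh t := by
  have hc := Real.cosh_pos t
  refine abs_le_of_sq_le_sq' ?_ (by positivity) |>.2
  rw [← Complex.normSq_eq_norm_sq, Complex.normSq_apply]
  simp only [hyperbolaDeriv, Complex.add_re, Complex.add_im, Complex.ofReal_re, Complex.ofReal_im,
    Complex.mul_re, Complex.mul_im, Complex.I_re, Complex.I_im]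
  nlinarith [Real.cosh_sq t]

/-- This is the derivative of `Re z³ / 3`; its sign for `t > 0`, opposite to `s`, drives the decay.
-/
theorem re_hyperbolaDeriv_mul_sq {s r : ℝ} (hs : s ^ 2 = 1) (hr : r ^ 2 = 3) (t : ℝ) :
    (hyperbolaDeriv s r t * hyperbola s r t ^ 2).re =
      -(s * ((8 * Real.cosh t ^ 2 - 3) * Real.sinh t)) := by
  simp only [hyperbola, hyperbolaDeriv, sq, Complex.add_re, Complex.add_im, Complex.ofReal_re,
    Complex.ofReal_im, Complex.mul_re, Complex.mul_im, Complex.I_re, Complex.I_im]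
  have h := Real.cosh_sq t
  linear_combination (s * Real.sinh t * Real.cosh t ^ 2) * hs
    - (s * Real.sinh t * (2 * Real.cosh t ^ 2 + Real.sinh t ^ 2)) * hr + 3 * s * Real.sinh t * h

theorem hasDerivAt_sum_norm_sq {v : ℝ → Fin N → ℂ} {v' : Fin N → ℂ} {t : ℝ}
    (hv : ∀ i, HasDerivAt (fun t => v t i) (v' i) t) :
    HasDerivAt (fun t => ∑ i, ‖v t i‖ ^ 2) (2 * (star (v t) ⬝ᵥ v').re) t := by
  have h : ∀ i, HasDerivAt (fun t => ‖v t i‖ ^ 2) (2 * (star (v t i) * v' i).re) t := fun i => by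
    have := (hv i).norm_sq
    simpa [Complex.inner, mul_comm] using this
  refine (HasDerivAt.fun_sum fun i (_ : i ∈ univ) => h i).congr_deriv ?_
  simp [dotProduct, Finset.mul_sum]

variable {lam mu nu : Matrix (Fin N) (Fin N) ℂ}

/-- Solutions of the Pearson equation decay faster than any exponential. -/
theorem isBigO_exp_of_pearson {s r δ : ℝ} (hs : s ^ 2 = 1) (hr : r ^ 2 = 3) (hδ : 0 < δ)
    (hnu : ∀ v : Fin N → ℂ, δ * ∑ k, ‖v k‖ ^ 2 ≤ s * (star v ⬝ᵥ (nu *ᵥ v)).re ∧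
      (star v ⬝ᵥ (nu *ᵥ v)).im = 0)
    {v : ℝ → Fin N → ℂ}
    (hv : ∀ t i, HasDerivAt (fun t => v t i) (hyperbolaDeriv s r t *
      ((lam + hyperbola s r t • mu + hyperbola s r t ^ 2 • nu) *ᵥ v t) i) t)
    (K : ℝ) (i : Fin N) :
    (fun t => v t i) =O[atTop] fun t => Real.exp (-(K * t)) := by
  set a := ∑ i, ∑ j, ‖lam i j‖
  set b := ∑ i, ∑ j, ‖mu i j‖
  have ha : 0 ≤ a := by positivity
  have hb : 0 ≤ b := by positivity
  set φ : ℝ → ℝ := fun t => ∑ i, ‖v t i‖ ^ 2 with hφ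
  have hφ0 : ∀ t, 0 ≤ φ t := fun t => by positivity
  have hφd := fun t => hasDerivAt_sum_norm_sq (hv t)
  -- Beyond `1`, `cosh ≤ 2 sinh`; beyond the other bound, `cosh t ≥ t / 2` lets the cubic term
  -- absorb those of `lam` and `mu` with `2K` to spare.
  set T : ℝ := max 1 (2 * ((4 * a + 8 * b + |2 * K|) / (5 * δ))) with hT
  have hbound : ∀ t, T ≤ t → 2 * (star (v t) ⬝ᵥ fun i => hyperbolaDeriv s r t *
      ((lam + hyperbola s r t • mu + hyperbola s r t ^ 2 • nu) *ᵥ v t) i).re ≤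
      -(2 * K) * φ t := by
    intro t ht
    have ht1 : 1 ≤ t := (le_max_left _ _).trans ht
    have hcs : Real.cosh t ≤ 2 * Real.sinh t := by
      rw [Real.cosh_eq, Real.sinh_eq]
      have h1 := Real.add_one_le_exp t
      have h2 : Real.exp (-t) ≤ 1 / 2 := by
        rw [Real.exp_neg, inv_eq_one_div]
        exact one_div_le_one_div_of_le (by norm_num) (by linarith)
      linarith
    have hct : t / 2 ≤ Real.cosh t := by
      rw [Real.cosh_eq]
      linarith [Real.add_one_le_exp t, Real.exp_pos (-t)]
    have hc1 := Real.one_le_cosh t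
    have hcK : 4 * a + 8 * b + |2 * K| ≤ 5 * δ * Real.cosh t := by
      rw [← div_le_iff₀' (by positivity)]
      linarith [(le_max_right _ _).trans ht]
    set c := Real.cosh t
    set z := hyperbola s r t with hz
    set w := hyperbolaDeriv s r t with hw
    have hzn : ‖z‖ ≤ 2 * c := norm_hyperbola_le hs hr t
    have hwn : ‖w‖ ≤ 2 * c := norm_hyperbolaDeriv_le hs hr t
    obtain ⟨hq, hqi⟩ := hnu (v t)
    have hexp : (star (v t) ⬝ᵥ fun i => w * ((lam + z • mu + z ^ 2 • nu) *ᵥ v t) i) =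
        w * (star (v t) ⬝ᵥ (lam *ᵥ v t)) + w * z * (star (v t) ⬝ᵥ (mu *ᵥ v t)) +
          w * z ^ 2 * (star (v t) ⬝ᵥ (nu *ᵥ v t)) := by
      have : (fun i => w * ((lam + z • mu + z ^ 2 • nu) *ᵥ v t) i) =
        w • ((lam + z • mu + z ^ 2 • nu) *ᵥ v t) := rfl
      rw [this, add_mulVec, add_mulVec, smul_mulVec, smul_mulVec, dotProduct_smul,
        dotProduct_add, dotProduct_add, dotProduct_smul, dotProduct_smul]
      simp only [smul_eq_mul]
      ring
    have h1 : (w * (star (v t) ⬝ᵥ (lam *ᵥ v t))).re ≤ 2 * c * (a * φ t) := by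
      refine (Complex.re_le_norm _).trans ?_
      rw [norm_mul]
      exact mul_le_mul hwn (norm_star_dotProduct_mulVec_le lam (v t)) (norm_nonneg _)
        (by linarith)
    have h2 : (w * z * (star (v t) ⬝ᵥ (mu *ᵥ v t))).re ≤ 2 * c * (2 * c) * (b * φ t) := by
      refine (Complex.re_le_norm _).trans ?_
      rw [norm_mul, norm_mul]
      exact mul_le_mul (mul_le_mul hwn hzn (norm_nonneg _) (by linarith))
        (norm_star_dotProduct_mulVec_le mu (v t)) (norm_nonneg _) (by positivity)
    -- The form of `nu` is real, so only `Re (w z²)` enters.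
    have h3 : (w * z ^ 2 * (star (v t) ⬝ᵥ (nu *ᵥ v t))).re =
        -((8 * c ^ 2 - 3) * Real.sinh t * (s * (star (v t) ⬝ᵥ (nu *ᵥ v t)).re)) := by
      rw [Complex.mul_re, hqi, re_hyperbolaDeriv_mul_sq hs hr]
      ring
    have h4 : 5 * c ^ 2 * (c / 2) * (δ * φ t) ≤
        (8 * c ^ 2 - 3) * Real.sinh t * (s * (star (v t) ⬝ᵥ (nu *ᵥ v t)).re) := by
      have hc2 : 5 * c ^ 2 ≤ 8 * c ^ 2 - 3 := by nlinarith
      have hδφ : 0 ≤ δ * φ t := mul_nonneg hδ.le (hφ0 t)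
      have hcp : 0 ≤ 5 * c ^ 2 := by positivity
      exact mul_le_mul (mul_le_mul hc2 (by linarith) (by linarith) (hcp.trans hc2)) hq hδφ
        (mul_nonneg (hcp.trans hc2) (by linarith))
    rw [hexp, Complex.add_re, Complex.add_re, h3]
    have h5 : 2 * K ≤ |2 * K| := le_abs_self _
    have h6 : 2 * c * a ≤ 2 * c ^ 2 * a := by nlinarith [mul_nonneg ha (by linarith : 0 ≤ c)]
    have h7 : |2 * K| ≤ c ^ 2 * |2 * K| :=
      le_mul_of_one_le_left (abs_nonneg _) (one_le_pow₀ hc1)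
    have h8 := mul_le_mul_of_nonneg_left hcK (sq_nonneg c)
    have h9 : 4 * c * a + 8 * c ^ 2 * b - 5 * c ^ 3 * δ ≤ -(2 * K) := by nlinarith
    have h10 := mul_le_mul_of_nonneg_right h9 (hφ0 t)
    linarith
  have hle := fun t (ht : T ≤ t) => le_mul_exp_of_deriv_le hφd hbound ht
  set A := φ T * Real.exp (2 * K * T)
  have hA : 0 ≤ A := mul_nonneg (hφ0 T) (Real.exp_pos _).le
  refine IsBigO.of_bound (Real.sqrt A) ((eventually_ge_atTop T).mono fun t ht => ?_)
  rw [Real.norm_of_nonneg (Real.exp_pos _).le]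
  refine abs_le_of_sq_le_sq' ?_ (by positivity) |>.2
  rw [mul_pow, Real.sq_sqrt hA, ← Real.exp_nat_mul]
  refine (single_le_sum (f := fun k => ‖v t k‖ ^ 2) (fun _ _ => by positivity)
    (mem_univ i)).trans ((hle t ht).trans_eq ?_)
  congr 2
  push_cast; ring

theorem hyperbola_isBigO_exp {s r : ℝ} (hs : s ^ 2 = 1) (hr : r ^ 2 = 3) :
    hyperbola s r =O[atTop] (fun t => Real.exp t) ∧
      hyperbolaDeriv s r =O[atTop] (fun t => Real.exp t) := by
  have h : ∀ t : ℝ, 0 ≤ t → Real.cosh t ≤ Real.exp t := fun t ht => by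
    rw [Real.cosh_eq]
    linarith [Real.exp_le_exp.2 (by linarith : -t ≤ t)]
  constructor <;> refine IsBigO.of_bound 2 ((eventually_ge_atTop 0).mono fun t ht => ?_) <;>
    rw [Real.norm_of_nonneg (Real.exp_pos _).le]
  · linarith [norm_hyperbola_le hs hr t, h t ht]
  · linarith [norm_hyperbolaDeriv_le hs hr t, h t ht]

theorem isBigO_exp_neg_of_pearson {s r δ : ℝ} (hs : s ^ 2 = 1) (hr : r ^ 2 = 3) (hδ : 0 < δ)
    (hnu : ∀ v : Fin N → ℂ, δ * ∑ k, ‖v k‖ ^ 2 ≤ s * (star v ⬝ᵥ (nu *ᵥ v)).re ∧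
      (star v ⬝ᵥ (nu *ᵥ v)).im = 0)
    {v : ℝ → Fin N → ℂ}
    (hv : ∀ t i, HasDerivAt (fun t => v t i) (hyperbolaDeriv s r t *
      ((lam + hyperbola s r t • mu + hyperbola s r t ^ 2 • nu) *ᵥ v t) i) t)
    (k : ℕ) (i : Fin N) :
    (fun t => hyperbola s r t ^ k * v t i) =O[atTop] (fun t => Real.exp (-t)) ∧
    (fun t => hyperbola s r t ^ k * v t i * hyperbolaDeriv s r t) =O[atTop]
      (fun t => Real.exp (-t)) := by
  obtain ⟨h1, h2⟩ := hyperbola_isBigO_exp hs hr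
  constructor
  -- The rate `k + 1` beats the growth `exp (k t)` of `z ^ k`; below, the velocity costs one more.
  · refine ((h1.pow k).mul (isBigO_exp_of_pearson hs hr hδ hnu hv (k + 1) i)).congr_right
      fun t => ?_
    rw [← Real.exp_nat_mul, ← Real.exp_add]
    congr 1; ring
  · refine (((h1.pow k).mul (isBigO_exp_of_pearson hs hr hδ hnu hv (k + 2) i)).mul h2).congr_right
      fun t => ?_
    rw [← Real.exp_nat_mul, ← Real.exp_add, ← Real.exp_add]
    congr 1; ring

theorem integrable_of_isBigO_exp {f : ℝ → ℂ} (hf : Continuous f)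
    (h1 : f =O[atTop] fun t => Real.exp (-t))
    (h2 : (fun t => f (-t)) =O[atTop] fun t => Real.exp (-t)) : MeasureTheory.Integrable f := by
  refine hf.locallyIntegrable.integrable_of_isBigO_atBot_atTop (g := fun t => Real.exp t)
    (g' := fun t => Real.exp (-t)) ?_ ⟨Set.Iic 0, Iic_mem_atBot 0, integrableOn_exp_Iic 0⟩ h1
    ⟨Set.Ioi 0, Ioi_mem_atTop 0, integrableOn_exp_neg_Ioi 0⟩
  simpa [Function.comp_def] using h2.comp_tendsto tendsto_neg_atBot_atTop

/-- The end `t → -∞` reduces to `t → +∞` on replacing `r` by `-r`, which reverses the curve; hence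
`r` is fixed only through `r ^ 2 = 3`. -/
theorem integrable_of_pearson {s r δ : ℝ} (hs : s ^ 2 = 1) (hr : r ^ 2 = 3) (hδ : 0 < δ)
    (hnu : ∀ v : Fin N → ℂ, δ * ∑ k, ‖v k‖ ^ 2 ≤ s * (star v ⬝ᵥ (nu *ᵥ v)).re ∧
      (star v ⬝ᵥ (nu *ᵥ v)).im = 0)
    {v : ℝ → Fin N → ℂ}
    (hv : ∀ t i, HasDerivAt (fun t => v t i) (hyperbolaDeriv s r t *
      ((lam + hyperbola s r t • mu + hyperbola s r t ^ 2 • nu) *ᵥ v t) i) t)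
    (k : ℕ) (i : Fin N) :
    MeasureTheory.Integrable (fun t => hyperbola s r t ^ k * v t i) ∧
    MeasureTheory.Integrable (fun t => hyperbola s r t ^ k * v t i * hyperbolaDeriv s r t) := by
  have hz : Continuous (hyperbola s r) :=
    continuous_iff_continuousAt.2 fun t => (hasDerivAt_hyperbola s r t).continuousAt
  have hz' : Continuous (hyperbolaDeriv s r) := by unfold hyperbolaDeriv; fun_prop
  have hvc : Continuous (fun t => v t i) :=
    continuous_iff_continuousAt.2 fun t => (hv t i).continuousAt
  have e1 : ∀ t, hyperbola s (-r) t = hyperbola s r (-t) := fun t => by simp [hyperbola]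
  have e2 : ∀ t, hyperbolaDeriv s (-r) t = -hyperbolaDeriv s r (-t) := fun t => by
    simp [hyperbolaDeriv]; ring
  have hv' : ∀ t i, HasDerivAt (fun t => v (-t) i) (hyperbolaDeriv s (-r) t *
      ((lam + hyperbola s (-r) t • mu + hyperbola s (-r) t ^ 2 • nu) *ᵥ v (-t)) i) t := by
    intro t i
    have := HasDerivAt.scomp t (hv (-t) i) (hasDerivAt_neg t)
    rw [e1, e2, neg_mul]
    simpa [Function.comp_def] using this
  obtain ⟨a1, a2⟩ := isBigO_exp_neg_of_pearson hs hr hδ hnu hv k i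
  obtain ⟨b1, b2⟩ := isBigO_exp_neg_of_pearson hs (by rwa [neg_sq]) hδ hnu hv' k i
  refine ⟨integrable_of_isBigO_exp ((hz.pow k).mul hvc) a1 ?_,
    integrable_of_isBigO_exp (((hz.pow k).mul hvc).mul hz') a2 ?_⟩
  · simpa only [e1] using b1
  · simpa only [e1, e2, mul_neg, isBigO_neg_left] using b2

/-- The integral of the total derivative `(z ^ k V)'` vanishes. -/
theorem integral_pearson {s r δ : ℝ} (hs : s ^ 2 = 1) (hr : r ^ 2 = 3) (hδ : 0 < δ)
    (hnu : ∀ v : Fin N → ℂ, δ * ∑ k, ‖v k‖ ^ 2 ≤ s * (star v ⬝ᵥ (nu *ᵥ v)).re ∧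
      (star v ⬝ᵥ (nu *ᵥ v)).im = 0)
    {v : ℝ → Fin N → ℂ}
    (hv : ∀ t i, HasDerivAt (fun t => v t i) (hyperbolaDeriv s r t *
      ((lam + hyperbola s r t • mu + hyperbola s r t ^ 2 • nu) *ᵥ v t) i) t)
    {I : ℕ → Fin N → ℂ}
    (hI : ∀ k i, I k i = ∫ t, hyperbola s r t ^ k * v t i * hyperbolaDeriv s r t)
    (k : ℕ) (i : Fin N) :
    (lam *ᵥ I k) i + (mu *ᵥ I (k + 1)) i + (nu *ᵥ I (k + 2)) i + k * I (k - 1) i = 0 := by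
  have hint := integrable_of_pearson hs hr hδ hnu hv
  set f : ℕ → Fin N → ℝ → ℂ := fun k i t => hyperbola s r t ^ k * v t i * hyperbolaDeriv s r t
    with hf
  have hmul : ∀ (M : Matrix (Fin N) (Fin N) ℂ) k,
      MeasureTheory.Integrable (fun t => ∑ l, M i l * f k l t) ∧
      ∫ t, ∑ l, M i l * f k l t = (M *ᵥ I k) i := by
    intro M k
    refine ⟨MeasureTheory.integrable_finsetSum _ fun l _ => (hint k l).2.const_mul _, ?_⟩
    rw [MeasureTheory.integral_finsetSum _ fun l _ => (hint k l).2.const_mul _]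
    simp only [mulVec, dotProduct, hI, MeasureTheory.integral_const_mul]
  have hd : ∀ t, HasDerivAt (fun t => hyperbola s r t ^ k * v t i)
      (∑ l, lam i l * f k l t + ∑ l, mu i l * f (k + 1) l t + ∑ l, nu i l * f (k + 2) l t +
        k * f (k - 1) i t) t := by
    intro t
    refine (((hasDerivAt_hyperbola s r t).fun_pow k).fun_mul (hv t i)).congr_deriv (Eq.symm ?_)
    rw [add_mulVec, add_mulVec, smul_mulVec, smul_mulVec]
    simp only [Pi.add_apply, Pi.smul_apply, smul_eq_mul, mulVec, dotProduct, mul_add,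
      Finset.mul_sum, hf]
    rw [add_comm]
    congr 1
    · ring
    · congr 1
      · congr 1 <;> refine sum_congr rfl fun l _ => ?_ <;> ring
      · refine sum_congr rfl fun l _ => ?_
        ring
  have h12 : MeasureTheory.Integrable fun t =>
      ∑ l, lam i l * f k l t + ∑ l, mu i l * f (k + 1) l t :=
    (hmul lam k).1.add (hmul mu (k + 1)).1
  have h123 : MeasureTheory.Integrable fun t =>
      ∑ l, lam i l * f k l t + ∑ l, mu i l * f (k + 1) l t + ∑ l, nu i l * f (k + 2) l t :=
    h12.add (hmul nu (k + 2)).1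
  have h4 : MeasureTheory.Integrable fun t => (k : ℂ) * f (k - 1) i t :=
    (hint (k - 1) i).2.const_mul _
  -- Integrability of both `z ^ k v` and its derivative removes the boundary terms.
  have h0 := MeasureTheory.integral_eq_zero_of_hasDerivAt_of_integrable hd (h123.add h4)
    (hint k i).1
  rw [MeasureTheory.integral_add h123 h4, MeasureTheory.integral_add h12 (hmul nu (k + 2)).1,
    MeasureTheory.integral_add (hmul lam k).1 (hmul mu (k + 1)).1, (hmul lam k).2,
    (hmul mu (k + 1)).2, (hmul nu (k + 2)).2, MeasureTheory.integral_const_mul, ← hI] at h0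
  exact h0

end Decay

/-! ### Transfer to the matrix weight `W` and its moments. -/

section Weight

open Matrix MeasureTheory

variable {N : ℕ} {lam mu nu : Matrix (Fin N) (Fin N) ℂ} {s : ℝ}
  {W : ℂ → Matrix (Fin N) (Fin N) ℂ}

theorem deriv_branch (s t : ℝ) : deriv (branch s) t = hyperbolaDeriv s (Real.sqrt 3) t :=
  (hasDerivAt_hyperbola s _ t).deriv

theorem exists_pos_le_of_posDef (hs : (s = -1 ∧ (-nu).PosDef) ∨ (s = 1 ∧ nu.PosDef)) :
    s ^ 2 = 1 ∧ ∃ δ : ℝ, 0 < δ ∧ ∀ v : Fin N → ℂ,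
      δ * ∑ k, ‖v k‖ ^ 2 ≤ s * (star v ⬝ᵥ (nu *ᵥ v)).re ∧ (star v ⬝ᵥ (nu *ᵥ v)).im = 0 := by
  have him : ∀ M : Matrix (Fin N) (Fin N) ℂ, M.PosDef → ∀ v, (star v ⬝ᵥ (M *ᵥ v)).im = 0 :=
    fun M hM v => ((Complex.le_def.1 (hM.posSemidef.dotProduct_mulVec_nonneg v)).2).symm
  rcases hs with ⟨rfl, h⟩ | ⟨rfl, h⟩ <;>
    obtain ⟨δ, hδ, hq⟩ := exists_pos_le_star_dotProduct_mulVec h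
  · refine ⟨by norm_num, δ, hδ, fun v => ⟨?_, ?_⟩⟩
    · simpa [neg_mulVec] using hq v
    · simpa [neg_mulVec] using him _ h v
  · exact ⟨by norm_num, δ, hδ, fun v => ⟨by simpa using hq v, him _ h v⟩⟩

/-- Each column of `W` solves the vector equation. A derivative within `Γ` suffices for the chain
rule, since the parametrization stays in `Γ`. -/
theorem PearsonOn.hasDerivAt (hW : PearsonOn lam mu nu (Set.range (branch s)) W) (j : Fin N)
    (t : ℝ) (i : Fin N) :
    HasDerivAt (fun t => W (branch s t) i j) (hyperbolaDeriv s (Real.sqrt 3) t *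
      ((lam + hyperbola s (Real.sqrt 3) t • mu + hyperbola s (Real.sqrt 3) t ^ 2 • nu) *ᵥ
        fun i => W (branch s t) i j) i) t :=
  (hW _ ⟨t, rfl⟩ i j).scomp_hasDerivAt t (hasDerivAt_hyperbola s (Real.sqrt 3) t)
    fun t => ⟨t, rfl⟩

theorem PearsonOn.integrable (hs : (s = -1 ∧ (-nu).PosDef) ∨ (s = 1 ∧ nu.PosDef))
    (hW : PearsonOn lam mu nu (Set.range (branch s)) W) (k : ℕ) (i j : Fin N) :
    Integrable fun t : ℝ => branch s t ^ k * W (branch s t) i j * deriv (branch s) t := by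
  obtain ⟨hs, δ, hδ, hnu⟩ := exists_pos_le_of_posDef hs
  simp only [deriv_branch]
  exact (integrable_of_pearson hs (Real.sq_sqrt (by norm_num)) hδ hnu (hW.hasDerivAt j) k i).2

theorem moment_apply (k : ℕ) (i j : Fin N) :
    moment s W k i j = (2 * (Real.pi : ℂ) * Complex.I)⁻¹ *
      ∫ t : ℝ, branch s t ^ k * W (branch s t) i j * deriv (branch s) t := rfl

/-- The Pearson equation for the moments. -/
theorem PearsonOn.moment_relation (hs : (s = -1 ∧ (-nu).PosDef) ∨ (s = 1 ∧ nu.PosDef))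
    (hW : PearsonOn lam mu nu (Set.range (branch s)) W) (k : ℕ) :
    lam * moment s W k + mu * moment s W (k + 1) + nu * moment s W (k + 2) +
      k * moment s W (k - 1) = 0 := by
  obtain ⟨hs, δ, hδ, hnu⟩ := exists_pos_le_of_posDef hs
  ext i j
  have h := integral_pearson hs (Real.sq_sqrt (by norm_num)) hδ hnu (hW.hasDerivAt j)
    (I := fun k i => ∫ t : ℝ, branch s t ^ k * W (branch s t) i j * deriv (branch s) t)
    (fun k i => by simp only [deriv_branch]; rfl) k i
  have hmul : ∀ (M : Matrix (Fin N) (Fin N) ℂ) k, (M * moment s W k) i j =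
      (2 * (Real.pi : ℂ) * Complex.I)⁻¹ * (M *ᵥ fun i =>
        ∫ t : ℝ, branch s t ^ k * W (branch s t) i j * deriv (branch s) t) i := by
    intro M k
    simp only [Matrix.mul_apply, moment_apply, mulVec, dotProduct, Finset.mul_sum]
    exact sum_congr rfl fun l _ => mul_left_comm _ _ _
  have hk : ((k : Matrix (Fin N) (Fin N) ℂ) * moment s W (k - 1)) i j =
      (2 * (Real.pi : ℂ) * Complex.I)⁻¹ * (k *
        ∫ t : ℝ, branch s t ^ (k - 1) * W (branch s t) i j * deriv (branch s) t) := by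
    rw [← nsmul_eq_mul, Matrix.smul_apply, moment_apply, nsmul_eq_mul, mul_left_comm]
  rw [Matrix.add_apply, Matrix.add_apply, Matrix.add_apply, hmul, hmul, hmul, hk, ← mul_add,
    ← mul_add, ← mul_add, h, mul_zero, Matrix.zero_apply]

/-- The integral of `z ^ k P(z) W(z)` in terms of the moments. -/
theorem curveInt_pow_smul_eval (hW : ∀ (k : ℕ) (i j : Fin N),
      Integrable fun t : ℝ => branch s t ^ k * W (branch s t) i j * deriv (branch s) t)
    (p : (Matrix (Fin N) (Fin N) ℂ)[X]) (k : ℕ) :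
    (∀ i j, Integrable fun t : ℝ => (branch s t ^ k • (p.eval (Matrix.scalar (Fin N) (branch s t))
      * W (branch s t))) i j * deriv (branch s) t) ∧
    curveInt s (fun z => z ^ k • (p.eval (Matrix.scalar (Fin N) z) * W z)) =
      momentFunctional (moment s W) (p * X ^ k) := by
  induction p using Polynomial.induction_on' with
  | add p q hp hq =>
    have hadd : ∀ i j, ∀ t : ℝ, (branch s t ^ k • ((p + q).eval
        (Matrix.scalar (Fin N) (branch s t)) * W (branch s t))) i j * deriv (branch s) t =
        (branch s t ^ k • (p.eval (Matrix.scalar (Fin N) (branch s t))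
          * W (branch s t))) i j * deriv (branch s) t +
        (branch s t ^ k • (q.eval (Matrix.scalar (Fin N) (branch s t))
          * W (branch s t))) i j * deriv (branch s) t := fun i j t => by
      rw [Polynomial.eval_add, add_mul, smul_add, Matrix.add_apply, add_mul]
    refine ⟨fun i j => ?_, ?_⟩
    · simp only [hadd]
      exact (hp.1 i j).add (hq.1 i j)
    · rw [add_mul, map_add, ← hp.2, ← hq.2]
      ext i j
      simp only [curveInt, Matrix.of_apply, Matrix.add_apply, hadd]
      rw [integral_add (hp.1 i j) (hq.1 i j), mul_add]
  | monomial n a =>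
    have hmon : ∀ i j, ∀ t : ℝ, (branch s t ^ k • ((monomial n a).eval
        (Matrix.scalar (Fin N) (branch s t)) * W (branch s t))) i j * deriv (branch s) t =
        ∑ l, a i l * (branch s t ^ (n + k) * W (branch s t) l j * deriv (branch s) t) :=
      fun i j t => by
      rw [Polynomial.eval_monomial, ← map_pow, mul_assoc, Matrix.scalar_apply,
        ← Matrix.smul_eq_diagonal_mul,
        Matrix.mul_smul, smul_smul, Matrix.smul_apply, Matrix.mul_apply, smul_eq_mul,
        Finset.mul_sum, Finset.sum_mul]
      refine sum_congr rfl fun l _ => ?_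
      ring
    refine ⟨fun i j => ?_, ?_⟩
    · simp only [hmon]
      exact integrable_finsetSum _ fun l _ => (hW _ _ _).const_mul _
    · rw [X_pow_eq_monomial, monomial_mul_monomial, mul_one, momentFunctional_monomial]
      ext i j
      simp only [curveInt, Matrix.of_apply, hmon, Matrix.mul_apply, moment_apply]
      rw [integral_finsetSum _ fun l _ => (hW _ _ _).const_mul _, Finset.mul_sum]
      simp only [integral_const_mul]
      exact sum_congr rfl fun l _ => mul_left_comm _ _ _

theorem IsLeftOrthogonal.isMonicOrthogonal {P : ℕ → (Matrix (Fin N) (Fin N) ℂ)[X]}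
    {C : ℕ → Matrix (Fin N) (Fin N) ℂ} (hP : IsLeftOrthogonal s W P C)
    (hW : ∀ (k : ℕ) (i j : Fin N),
      Integrable fun t : ℝ => branch s t ^ k * W (branch s t) i j * deriv (branch s) t) :
    IsMonicOrthogonal (moment s W) P fun n => (hP.isUnit n).unit where
  degree_le := hP.degree_le
  coeff_self := hP.coeff_self
  orthogonal n k hk := by
    rw [← (curveInt_pow_smul_eval hW _ _).2, hP.orthogonal n k hk.le, if_neg hk.ne']
  normalized n := by
    rw [← (curveInt_pow_smul_eval hW _ _).2, hP.orthogonal n n le_rfl, if_pos rfl,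
      Matrix.coe_units_inv, IsUnit.unit_spec]

end Weight

end AltDPI

theorem mainTheorem9 {N : ℕ} (lam mu nu : Matrix (Fin N) (Fin N) ℂ) (s : ℝ)
    (hs : (s = -1 ∧ (-nu).PosDef) ∨ (s = 1 ∧ nu.PosDef))
    (W : ℂ → Matrix (Fin N) (Fin N) ℂ)
    (hW : AltDPI.PearsonOn lam mu nu (Set.range (AltDPI.branch s)) W) :
    -- all moments converge absolutely
    (∀ (k : ℕ) (i j : Fin N), MeasureTheory.Integrable (fun t : ℝ =>
      AltDPI.branch s t ^ k * W (AltDPI.branch s t) i j * deriv (AltDPI.branch s) t)) ∧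
    (AltDPI.IsRegular s W →
      ∀ (P : ℕ → Polynomial (Matrix (Fin N) (Fin N) ℂ)) (C : ℕ → Matrix (Fin N) (Fin N) ℂ),
        AltDPI.IsLeftOrthogonal s W P C →
    ∀ n : ℕ,
      -- the system for the recursion coefficients
      AltDPI.coeffA mu nu (AltDPI.recBeta P) n * AltDPI.recGamma C (n + 1)
        = -((n : ℂ) + 1) • (1 : Matrix (Fin N) (Fin N) ℂ) ∧
      AltDPI.altDPI lam mu nu (AltDPI.recBeta P) (AltDPI.recGamma C) n = 0 ∧
      -- the reformulation: elimination of the `γ`'s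
      IsUnit (AltDPI.coeffA mu nu (AltDPI.recBeta P) n) ∧
      AltDPI.recGamma C (n + 1)
        = -((n : ℂ) + 1) • (AltDPI.coeffA mu nu (AltDPI.recBeta P) n)⁻¹ ∧
      AltDPI.altDPI lam mu nu (AltDPI.recBeta P)
        (AltDPI.gammaOfBeta mu nu (AltDPI.recBeta P)) n = 0) := by
  have hint := fun k i j => hW.integrable hs k i j
  refine ⟨hint, fun _ P C hP n => ?_⟩
  have hsys := fun n => (hP.isMonicOrthogonal hint).altDPI_system
    (fun n => (hP.isUnit n).unit_spec.symm) (hW.moment_relation hs) n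
  obtain ⟨hA, hγ⟩ := AltDPI.altDPI_elimination (γ := AltDPI.recGamma C) rfl fun n => (hsys n).1
  refine ⟨(hsys n).1, (hsys n).2, hA n, congrFun hγ (n + 1), ?_⟩
  -- `hγ` equates whole sequences, so every `γ` in the second equation is replaced at once.
  rw [← hγ]
  exact (hsys n).2
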